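/- Let $V$ be a finite nonempty set, let $K_V$ be the complete undirected graph on $V$, and let $r\colon V\times V\to\mathbb{Z}_+$ be a symmetric connectivity requirement, i.e. $r(i,j)=r(j,i)$. For $\emptyset\neq X\subsetneq V$ put $R(X):=\max\{r(i,j)\mid i\in X,\ j\in V\setminus X\}$. For a graph $G$ and a set $X$ of its nodes, $\delta_G(X)$ denotes the set of edges of $G$ connecting $X$ and its complement, and $\delta_G(w):=\delta_G(\{w\})$. An integer realization of $r$ is a function $y\colon E(K_V)\to\mathbb{Z}_+$ such that $\sum_{e\in\delta_{K_V}(X)}y(e)\ge r(s,t)$ for all distinct $s,t\in V$ and all $X\subseteq V$ with $s\in X$, $t\notin X$. Let $T$ be a finite tree with $V\subseteq V(T)$, let $l\colon E(T)\to\mathbb{R}_+$ be a nonnegative edge-length, and let $a\colon E(K_V)\to\mathbb{R}_+$ be the tree metric represented by $T$ and $l$: for all distinct $i,j\in V$, $a(ij)$ is the length with respect to $l$ of the unique path between $i$ and $j$ in $T$. The cost of an integer realization $y$ is $\sum_{e\in E(K_V)}a(e)y(e)$. Fix an arbitrary $v\in V$ and, for $e\in E(T)$, let $X_e\subseteq V$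 be the set of nodes of $V$ reachable from $v$ in $T$ without using $e$. A function $c\colon E(T)\to\mathbb{Z}_+$ is called $r$-feasible if $\sum_{e\in\delta_T(w)}c(e)$ is even for every $w\in V(T)\setminus V$ and $c(e)\ge R(X_e)$ for every $e\in E(T)$; its cost is $\sum_{e\in E(T)}l(e)c(e)$. Suppose that, for every $e\in E(T)$, $X_e\neq V$ and $R(X_e)>1$. Then the minimum cost of an integer realization of $r$ and the minimum cost of an $r$-feasible capacity $c\colon E(T)\to\mathbb{Z}_+$ both exist (are attained), and they are equal. -/

import Mathlib

namespace NetworkSynthesis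

/-- The set `δ_G(X)` of edges of `G` connecting `X` and its complement. -/
noncomputable def cut {α : Type*} [Fintype α] (G : SimpleGraph α) (X : Set α) :
    Finset (Sym2 α) :=
  open scoped Classical in
  {e ∈ G.edgeFinset | ∃ x ∈ X, ∃ y ∉ X, e = s(x, y)}

/-- The cost `∑_{e ∈ E(G)} w(e) c(e)` of a capacity `c` under the edge weight `w`.
Functions on `E(G)` are written as functions on all unordered pairs, of which
only the values on `E(G)` are ever used. -/
noncomputable def cost {α : Type*} [Fintype α] (G : SimpleGraph α) (w : Sym2 α → ℝ)
    (c : Sym2 α → ℝ) : ℝ :=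
  open scoped Classical in
  ∑ e ∈ G.edgeFinset, w e * c e

/-- `y : E(K_V) → ℝ₊` is a realization of the connectivity requirement `r`: every node set
separating `s` from `t` has cut capacity at least `r s t`. -/
def IsRealization {V : Type*} [Fintype V] (r : V → V → ℕ) (y : Sym2 V → ℝ) : Prop :=
  (∀ e ∈ (⊤ : SimpleGraph V).edgeSet, 0 ≤ y e) ∧
    ∀ s t : V, s ≠ t → ∀ X : Set V, s ∈ X → t ∉ X →
      (r s t : ℝ) ≤ ∑ e ∈ cut (⊤ : SimpleGraph V) X, y e

/-- `y : E(K_V) → ℤ₊` is an integer realization of `r`. -/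
def IsIntegerRealization {V : Type*} [Fintype V] (r : V → V → ℕ) (y : Sym2 V → ℕ) : Prop :=
  IsRealization r (fun e => (y e : ℝ))

/-- `R(X) = max {r i j | i ∈ X, j ∉ X}`, for `∅ ≠ X ⊂ V` (and `0` when there is no such pair). -/
noncomputable def maxReq {V : Type*} [Fintype V] (r : V → V → ℕ) (X : Set V) : ℕ :=
  open scoped Classical in
  ({p : V × V | p.1 ∈ X ∧ p.2 ∉ X} : Finset (V × V)).sup (fun p => r p.1 p.2)

/-- The edge-cost `a` on `K_V` is the tree metric represented by the tree `T` on `W ⊇ V` and the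
edge-length `l`: for distinct `i, j ∈ V`, `a(ij)` is the length of the path from `i` to `j`. -/
def IsRepresentedBy {W : Type*} {V : Finset W} (a : Sym2 V → ℝ) (T : SimpleGraph W)
    (l : Sym2 W → ℝ) : Prop :=
  ∀ i j : V, i ≠ j → ∀ p : T.Walk (i : W) (j : W), p.IsPath → a s(i, j) = (p.edges.map l).sum

/-- `X_e`: the nodes of `V` reachable from `v` in `T` without using the edge `e`. -/
def side {W : Type*} {V : Finset W} (T : SimpleGraph W) (v : V) (e : Sym2 W) : Set V :=
  {u : V | (T.deleteEdges {e}).Reachable (v : W) (u : W)}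

/-- `c : E(T) → ℤ₊` is `r`-feasible. -/
def IsFeasible {W : Type*} [Fintype W] {V : Finset W} (T : SimpleGraph W) (r : V → V → ℕ)
    (v : V) (c : Sym2 W → ℕ) : Prop :=
  (∀ w : W, w ∉ V → Even (∑ e ∈ cut T {w}, c e)) ∧
    ∀ e ∈ T.edgeSet, maxReq r (side T v e) ≤ c e

end NetworkSynthesis

/-! Both inequalities come from moving capacity between `K_V` and the tree. Given a realization `y`,
route each pair along its tree path: the load of a tree edge `e` is the `y`-capacity of the cut
`X_e`, hence at least `R(X_e)`; paths pass evenly through nodes outside `V`; and the cost is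
unchanged because `a` is the path length (`isFeasible_treeLoad`, `cost_treeLoad`).

Conversely, read a feasible `c` as a multigraph on the tree nodes and split off pairs of edges at
nodes outside `V`, replacing `su`, `sx` by `ux`, until only edges inside `V` (and loops) remain. The
triangle inequality keeps the cost from growing. That the requirement survives is a Mader-type
splitting theorem (`exists_split`). It needs every nonempty cut to have at least two edges, which is
what `R(X_e) > 1` and the parity condition provide.

For the splitting theorem, a pair `su`, `sx` fails only if a dangerous set contains `u` and `x`. If
every partner of `u` failed, take a smallest family of maximal dangerous sets covering the
neighbours of `s`. It has at least three members; uncrossing makes it a sunflower with a tight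
kernel, and counting edges at the kernel refutes that (`not_covered`, `false_of_sunflower`). -/

namespace NetworkSynthesis

/-! ### Cut functions of multigraphs and the requirement function -/

section Cuts

variable {W : Type*} [Fintype W] [DecidableEq W]

/-- The indicator of the unordered pairs with one end in `A` and the other one in `B`. -/
def joins (A B : Finset W) : Sym2 W → ℕ :=
  Sym2.lift ⟨fun a b => if (a ∈ A ∧ b ∈ B) ∨ (b ∈ A ∧ a ∈ B) then 1 else 0, fun a b => by
    simp only [or_comm]⟩

omit [Fintype W] in
@[simp] theorem joins_mk (A B : Finset W) (a b : W) :
    joins A B s(a, b) = if (a ∈ A ∧ b ∈ B) ∨ (b ∈ A ∧ a ∈ B) then 1 else 0 := rfl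

/-- The number of edges of the multigraph `E` connecting `A` and `B`. -/
def between (E : Multiset (Sym2 W)) (A B : Finset W) : ℕ := (E.map (joins A B)).sum

/-- The number of edges of the multigraph `E` leaving `X`. -/
def cutSize (E : Multiset (Sym2 W)) (X : Finset W) : ℕ := between E X Xᶜ

omit [Fintype W] in
@[simp] theorem between_zero (A B : Finset W) : between 0 A B = 0 := rfl

omit [Fintype W] in
@[simp] theorem between_cons (e : Sym2 W) (E : Multiset (Sym2 W)) (A B : Finset W) :
    between (e ::ₘ E) A B = joins A B e + between E A B := by
  simp [between]

@[simp] theorem cutSize_zero (X : Finset W) : cutSize 0 X = 0 := rfl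

@[simp] theorem cutSize_cons (e : Sym2 W) (E : Multiset (Sym2 W)) (X : Finset W) :
    cutSize (e ::ₘ E) X = joins X Xᶜ e + cutSize E X := by
  simp [cutSize]

omit [Fintype W] in
theorem between_comm (E : Multiset (Sym2 W)) (A B : Finset W) :
    between E A B = between E B A := by
  induction E using Multiset.induction_on with
  | empty => rfl
  | cons e E ih =>
    induction e with | _ a b
    simp only [between_cons, ih, joins_mk, and_comm, or_comm]

omit [Fintype W] in
theorem between_mono (E : Multiset (Sym2 W)) {A A' B B' : Finset W} (hA : A ⊆ A') (hB : B ⊆ B') :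
    between E A B ≤ between E A' B' := by
  induction E using Multiset.induction_on with
  | empty => simp
  | cons e E ih =>
    induction e with | _ a b
    simp only [between_cons, joins_mk]
    refine add_le_add ?_ ih
    have h1 := @hA a
    have h2 := @hA b
    have h3 := @hB a
    have h4 := @hB b
    split_ifs <;> first | omega | tauto

omit [Fintype W] in
theorem between_union_right (E : Multiset (Sym2 W)) {A B C : Finset W} (hAB : Disjoint A B)
    (hAC : Disjoint A C) (hBC : Disjoint B C) :
    between E A (B ∪ C) = between E A B + between E A C := by
  induction E using Multiset.induction_on with
  | empty => rfl
  | cons e E ih =>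
    induction e with | _ a b
    have : joins A (B ∪ C) s(a, b) = joins A B s(a, b) + joins A C s(a, b) := by
      rw [Finset.disjoint_left] at hAB hAC hBC
      have h1 := @hAB a
      have h2 := @hAB b
      have h3 := @hAC a
      have h4 := @hAC b
      have h5 := @hBC a
      have h6 := @hBC b
      clear hAB hAC hBC ih
      simp only [joins_mk, Finset.mem_union]
      by_cases ha : a ∈ A <;> by_cases hb : b ∈ A <;> simp only [ha, hb, true_and, false_and,
        forall_const, IsEmpty.forall_iff, not_false_eq_true] at * <;>
        by_cases a ∈ B <;> by_cases b ∈ B <;> simp_all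
    simp only [between_cons]
    omega

omit [Fintype W] in
theorem between_pos_iff (E : Multiset (Sym2 W)) (A B : Finset W) :
    0 < between E A B ↔ ∃ a ∈ A, ∃ b ∈ B, s(a, b) ∈ E := by
  rw [between, pos_iff_ne_zero, ne_eq, Multiset.sum_eq_zero_iff]
  simp only [Multiset.mem_map, forall_exists_index, and_imp, forall_apply_eq_imp_iff₂]
  push Not
  simp only [← pos_iff_ne_zero]
  constructor
  · rintro ⟨e, he, hpos⟩
    induction e with | _ a b
    simp only [joins_mk] at hpos
    split_ifs at hpos with h
    · rcases h with h | h
      · exact ⟨a, h.1, b, h.2, he⟩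
      · exact ⟨b, h.1, a, h.2, Sym2.eq_swap ▸ he⟩
    · omega
  · rintro ⟨a, ha, b, hb, he⟩
    exact ⟨s(a, b), he, by simp [ha, hb]⟩

theorem cutSize_compl (E : Multiset (Sym2 W)) (X : Finset W) : cutSize E Xᶜ = cutSize E X := by
  rw [cutSize, cutSize, compl_compl, between_comm]

theorem between_le_cutSize (E : Multiset (Sym2 W)) {A B : Finset W} (h : Disjoint A B) :
    between E A B ≤ cutSize E A :=
  between_mono E subset_rfl h.le_compl_left

theorem cutSize_inter_add_cutSize_union_le (E : Multiset (Sym2 W)) (X Y : Finset W) :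
    cutSize E (X ∩ Y) + cutSize E (X ∪ Y) ≤ cutSize E X + cutSize E Y := by
  induction E using Multiset.induction_on with
  | empty => simp
  | cons e E ih =>
    induction e with | _ a b
    have : joins (X ∩ Y) (X ∩ Y)ᶜ s(a, b) + joins (X ∪ Y) (X ∪ Y)ᶜ s(a, b) ≤
        joins X Xᶜ s(a, b) + joins Y Yᶜ s(a, b) := by
      simp only [joins_mk, Finset.mem_inter, Finset.mem_union, Finset.mem_compl]
      by_cases a ∈ X <;> by_cases b ∈ X <;> by_cases a ∈ Y <;> by_cases b ∈ Y <;> simp [*]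
    simp only [cutSize_cons]
    omega

theorem cutSize_sdiff_add_cutSize_sdiff_le (E : Multiset (Sym2 W)) (X Y : Finset W) :
    cutSize E (X \ Y) + cutSize E (Y \ X) + 2 * between E (X ∩ Y) (X ∪ Y)ᶜ ≤
      cutSize E X + cutSize E Y := by
  induction E using Multiset.induction_on with
  | empty => simp
  | cons e E ih =>
    induction e with | _ a b
    have : joins (X \ Y) (X \ Y)ᶜ s(a, b) + joins (Y \ X) (Y \ X)ᶜ s(a, b) +
        2 * joins (X ∩ Y) (X ∪ Y)ᶜ s(a, b) ≤ joins X Xᶜ s(a, b) + joins Y Yᶜ s(a, b) := by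
      simp only [joins_mk, Finset.mem_inter, Finset.mem_union, Finset.mem_compl, Finset.mem_sdiff]
      by_cases a ∈ X <;> by_cases b ∈ X <;> by_cases a ∈ Y <;> by_cases b ∈ Y <;> simp [*]
    simp only [cutSize_cons, between_cons]
    omega

theorem cutSize_union_add (E : Multiset (Sym2 W)) {A B : Finset W} (h : Disjoint A B) :
    cutSize E (A ∪ B) + 2 * between E A B = cutSize E A + cutSize E B := by
  induction E using Multiset.induction_on with
  | empty => simp
  | cons e E ih =>
    induction e with | _ a b
    have : joins (A ∪ B) (A ∪ B)ᶜ s(a, b) + 2 * joins A B s(a, b) =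
        joins A Aᶜ s(a, b) + joins B Bᶜ s(a, b) := by
      rw [Finset.disjoint_left] at h
      have h1 := @h a
      have h2 := @h b
      simp only [joins_mk, Finset.mem_union, Finset.mem_compl]
      by_cases ha : a ∈ A <;> by_cases hb : b ∈ A <;> by_cases ha' : a ∈ B <;>
        by_cases hb' : b ∈ B <;> simp_all
    simp only [cutSize_cons, between_cons]
    omega

theorem even_cutSize (E : Multiset (Sym2 W)) (A : Finset W)
    (h : ∀ w ∈ A, Even (cutSize E {w})) : Even (cutSize E A) := by
  induction A using Finset.induction_on with
  | empty =>
    have : between E ∅ ∅ᶜ = 0 := by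
      by_contra h0
      obtain ⟨a, ha, -⟩ := (between_pos_iff E _ _).1 (Nat.pos_of_ne_zero h0)
      simp at ha
    rw [cutSize, this]
    exact Even.zero
  | insert w A hw ih =>
    have h1 := h w (Finset.mem_insert_self _ _)
    have h2 := ih fun x hx => h x (Finset.mem_insert_of_mem hx)
    have h3 := cutSize_union_add E (Finset.disjoint_singleton_left.2 hw)
    rw [Finset.insert_eq]
    rw [Nat.even_iff] at *
    omega

/-- The largest requirement between a node of `X` and a node outside `X`. -/
def req (ρ : W → W → ℕ) (X : Finset W) : ℕ := (X ×ˢ Xᶜ).sup fun p => ρ p.1 p.2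

variable {ρ : W → W → ℕ}

theorem le_req (hρ : ∀ i j, ρ i j = ρ j i) {X : Finset W} {i j : W} (h : ¬(i ∈ X ↔ j ∈ X)) :
    ρ i j ≤ req ρ X := by
  by_cases hi : i ∈ X
  · exact Finset.le_sup (f := fun p : W × W => ρ p.1 p.2) (b := (i, j))
      (by simp only [Finset.mem_product, Finset.mem_compl]; tauto)
  · rw [hρ]
    exact Finset.le_sup (f := fun p : W × W => ρ p.1 p.2) (b := (j, i))
      (by simp only [Finset.mem_product, Finset.mem_compl]; tauto)

theorem exists_req_eq {X : Finset W} (h : 0 < req ρ X) : ∃ i ∈ X, ∃ j ∉ X, req ρ X = ρ i j := by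
  have hne : (X ×ˢ Xᶜ).Nonempty := by
    by_contra h0
    rw [Finset.not_nonempty_iff_eq_empty] at h0
    simp [req, h0] at h
  obtain ⟨p, hp, he⟩ := Finset.exists_mem_eq_sup _ hne fun p : W × W => ρ p.1 p.2
  simp only [Finset.mem_product, Finset.mem_compl] at hp
  exact ⟨p.1, hp.1, p.2, hp.2, he⟩

theorem req_le_iff (hρ : ∀ i j, ρ i j = ρ j i) {X : Finset W} {k : ℕ} :
    req ρ X ≤ k ↔ ∀ i ∈ X, ∀ j ∉ X, ρ i j ≤ k := by
  constructor
  · intro h i hi j hj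
    exact (le_req hρ (by tauto)).trans h
  · intro h
    refine Finset.sup_le fun p hp => ?_
    simp only [Finset.mem_product, Finset.mem_compl] at hp
    exact h _ hp.1 _ hp.2

theorem req_compl (hρ : ∀ i j, ρ i j = ρ j i) (X : Finset W) : req ρ Xᶜ = req ρ X := by
  apply le_antisymm
  · rw [req_le_iff hρ]
    intro i hi j hj
    exact le_req hρ (by simp at hi hj; tauto)
  · rw [req_le_iff hρ]
    intro i hi j hj
    exact le_req hρ (by simp; tauto)

/-- Take maximising pairs for `X` and `Y`. A pair in adjacent quadrants is separated by one of `X ∩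
Y`, `X ∪ Y` and by one of the differences, and two such pairs get distinct sets in one alternative.
A pair in opposite quadrants is separated by both sets of one alternative and by both `X` and `Y`,
so comparing the two maxima settles this case. -/
theorem req_skew_supermodular (hρ : ∀ i j, ρ i j = ρ j i) (X Y : Finset W) :
    req ρ X + req ρ Y ≤ req ρ (X ∩ Y) + req ρ (X ∪ Y) ∨
      req ρ X + req ρ Y ≤ req ρ (X \ Y) + req ρ (Y \ X) := by
  have key : ∀ i j k l, i ∈ X → j ∉ X → k ∈ Y → l ∉ Y →
      req ρ X = ρ i j → req ρ Y = ρ k l →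
      req ρ X + req ρ Y ≤ req ρ (X ∩ Y) + req ρ (X ∪ Y) ∨
      req ρ X + req ρ Y ≤ req ρ (X \ Y) + req ρ (Y \ X) := by
    intro i j k l hi hj hk hl hX hY
    have h1 := @le_req _ _ _ _ hρ (X ∩ Y) i j
    have h2 := @le_req _ _ _ _ hρ (X ∪ Y) i j
    have h3 := @le_req _ _ _ _ hρ (X \ Y) i j
    have h4 := @le_req _ _ _ _ hρ (Y \ X) i j
    have h5 := @le_req _ _ _ _ hρ (X ∩ Y) k l
    have h6 := @le_req _ _ _ _ hρ (X ∪ Y) k l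
    have h7 := @le_req _ _ _ _ hρ (X \ Y) k l
    have h8 := @le_req _ _ _ _ hρ (Y \ X) k l
    have h9 := @le_req _ _ _ _ hρ Y i j
    have h10 := @le_req _ _ _ _ hρ X k l
    simp only [Finset.mem_inter, Finset.mem_union, Finset.mem_sdiff] at h1 h2 h3 h4 h5 h6 h7 h8
    rw [hX, hY] at *
    by_cases i ∈ Y <;> by_cases j ∈ Y <;> by_cases k ∈ X <;> by_cases l ∈ X <;>
      simp_all <;> omega
  rcases Nat.eq_zero_or_pos (req ρ X) with hX | hX
  · rcases Nat.eq_zero_or_pos (req ρ Y) with hY | hY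
    · simp [hX, hY]
    obtain ⟨k, hk, l, hl, he⟩ := exists_req_eq hY
    have h5 := @le_req _ _ _ _ hρ (X ∩ Y) k l
    have h8 := @le_req _ _ _ _ hρ (Y \ X) k l
    simp only [Finset.mem_inter, Finset.mem_sdiff] at h5 h8
    by_cases k ∈ X <;> simp_all <;> omega
  · obtain ⟨i, hi, j, hj, hXe⟩ := exists_req_eq hX
    rcases Nat.eq_zero_or_pos (req ρ Y) with hY | hY
    · have h5 := @le_req _ _ _ _ hρ (X ∩ Y) i j
      have h8 := @le_req _ _ _ _ hρ (X \ Y) i j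
      simp only [Finset.mem_inter, Finset.mem_sdiff] at h5 h8
      by_cases i ∈ Y <;> simp_all <;> omega
    · obtain ⟨k, hk, l, hl, he⟩ := exists_req_eq hY
      exact key i j k l hi hj hk hl hXe he

end Cuts

/-! ### Dangerous sets and uncrossing -/

section Splitting

variable {W : Type*} [Fintype W] [DecidableEq W]

/-- The multigraph `E` satisfies the requirement `ρ`, no cut has size one, and `s` is a node of
even degree without requirements. -/
structure IsSplitReady (E : Multiset (Sym2 W)) (ρ : W → W → ℕ) (s : W) : Prop where
  symm : ∀ i j, ρ i j = ρ j i
  req_le : ∀ X, req ρ X ≤ cutSize E X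
  zero : ∀ j, ρ s j = 0
  even : Even (cutSize E {s})
  two_le : ∀ A, 0 < cutSize E A → 2 ≤ cutSize E A

/-- `M` contains `u` but not `s`, and its cut exceeds the requirement by at most one. -/
structure IsDangerous (E : Multiset (Sym2 W)) (ρ : W → W → ℕ) (s u : W) (M : Finset W) : Prop where
  notMem : s ∉ M
  mem : u ∈ M
  le : cutSize E M ≤ req ρ M + 1

variable {E : Multiset (Sym2 W)} {ρ : W → W → ℕ} {s u : W}

omit [Fintype W] in
theorem between_pos_of_mem {x : W} {X : Finset W} (hx : s(s, x) ∈ E) (hX : x ∈ X) :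
    0 < between E {s} X :=
  (between_pos_iff E _ _).2 ⟨s, by simp, x, hX, hx⟩

theorem cutSize_pos_of_mem {x : W} {X : Finset W} (hx : s(s, x) ∈ E) (hX : x ∈ X) (hs : s ∉ X) :
    0 < cutSize E X :=
  (between_pos_iff E _ _).2 ⟨x, hX, s, by simpa using hs, Sym2.eq_swap ▸ hx⟩

theorem between_add_between_compl (E : Multiset (Sym2 W)) {X : Finset W} (hs : s ∉ X) :
    between E {s} X + between E {s} (insert s X)ᶜ = cutSize E {s} := by
  rw [← between_union_right]
  · rw [cutSize]
    congr 1
    ext x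
    simp only [Finset.mem_union, Finset.mem_compl, Finset.mem_insert, Finset.mem_singleton]
    by_cases h : x = s
    · simp [h, hs]
    · tauto
  · simpa using hs
  · simp
  · rw [Finset.disjoint_left]
    intro x hx
    simp [hx]

theorem cutSize_compl_insert (E : Multiset (Sym2 W)) {X : Finset W} (hs : s ∉ X) :
    cutSize E (insert s X)ᶜ + between E {s} X = cutSize E X + between E {s} (insert s X)ᶜ := by
  have h1 := between_add_between_compl E hs
  have h2 := cutSize_union_add E (Finset.disjoint_singleton_left.2 hs)
  rw [← Finset.insert_eq] at h2
  rw [cutSize_compl]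
  omega

namespace IsSplitReady

/-- Since `s` carries no requirement, moving it across the cut loses no demanding pair. -/
theorem req_le_cutSize_compl_insert (H : IsSplitReady E ρ s) (X : Finset W) :
    req ρ X ≤ cutSize E (insert s X)ᶜ := by
  refine le_trans ?_ (H.req_le _)
  rw [req_compl H.symm, req_le_iff H.symm]
  intro i hi j hj
  by_cases h : j = s
  · rw [h, H.symm, H.zero]
    exact Nat.zero_le _
  · exact le_req H.symm (by simp [hi, hj, h])

/-- Moving `s` into `M` changes the cut by the edges from `s` to the rest minus those from `s` to
`M`. As `M` has slack at most one, `M` receives at most one edge more than the rest, and the even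
degree of `s` removes that one. -/
theorem two_mul_between_le (H : IsSplitReady E ρ s) {M : Finset W} (hM : IsDangerous E ρ s u M) :
    2 * between E {s} M ≤ cutSize E {s} := by
  have h1 := H.req_le_cutSize_compl_insert M
  have h2 := cutSize_compl_insert E hM.notMem
  have h3 := between_add_between_compl E hM.notMem
  have h4 := hM.le
  have h5 := H.even
  rw [Nat.even_iff] at h5
  omega

/-- The cuts of `P` and `Q` add up. One of them already pays for the pair attaining the requirement
of the union, and the other contributes two more edges. -/
theorem req_add_two_le (H : IsSplitReady E ρ s) {P Q : Finset W} (hPQ : Disjoint P Q)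
    (h0 : between E P Q = 0) (hP : 0 < cutSize E P) (hQ : 0 < cutSize E Q) :
    req ρ (P ∪ Q) + 2 ≤ cutSize E (P ∪ Q) := by
  have h1 := cutSize_union_add E hPQ
  have h2 := H.two_le P hP
  have h3 := H.two_le Q hQ
  have h4 := H.req_le P
  have h5 := H.req_le Q
  rcases Nat.eq_zero_or_pos (req ρ (P ∪ Q)) with h | h
  · omega
  · obtain ⟨i, hi, j, hj, he⟩ := exists_req_eq h
    simp only [Finset.mem_union, not_or] at hi hj
    rcases hi with hi | hi
    · have := @le_req _ _ _ _ H.symm P i j (by tauto)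
      omega
    · have := @le_req _ _ _ _ H.symm Q i j (by tauto)
      omega

/-- The total slack of `M` and `Z` is at most one. In the difference case an edge from `M ∩ Z` to
the outside would cost two. -/
theorem uncross (H : IsSplitReady E ρ s) {M Z : Finset W} (hM : cutSize E M ≤ req ρ M + 1)
    (hZ : cutSize E Z ≤ req ρ Z) :
    cutSize E (M ∪ Z) ≤ req ρ (M ∪ Z) + 1 ∨
      cutSize E (M \ Z) ≤ req ρ (M \ Z) + 1 ∧ between E (M ∩ Z) (M ∪ Z)ᶜ = 0 := by
  have h1 := cutSize_inter_add_cutSize_union_le E M Z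
  have h2 := cutSize_sdiff_add_cutSize_sdiff_le E M Z
  have h3 := H.req_le (M ∩ Z)
  have h4 := H.req_le (Z \ M)
  have h5 := H.req_le (M \ Z)
  rcases req_skew_supermodular H.symm M Z with h | h
  · left
    omega
  · right
    omega

/-- No pair of sets of a minimal family of dangerous sets is uncrossed by its differences. -/
theorem req_sdiff_add_req_sdiff_lt (H : IsSplitReady E ρ s) (hu : s(s, u) ∈ E)
    {M₁ M₂ M₃ : Finset W}
    (h₁ : IsDangerous E ρ s u M₁) (h₂ : IsDangerous E ρ s u M₂) (h₃ : IsDangerous E ρ s u M₃)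
    (hx : ∃ x ∈ M₃, x ∉ M₁ ∧ x ∉ M₂ ∧ s(s, x) ∈ E)
    (hmin₁ : ∀ D, IsDangerous E ρ s u D → ¬ M₁ ∪ M₃ ⊆ D ∪ M₂)
    (hmin₂ : ∀ D, IsDangerous E ρ s u D → ¬ M₂ ∪ M₃ ⊆ D ∪ M₁) :
    req ρ (M₁ \ M₂) + req ρ (M₂ \ M₁) < req ρ M₁ + req ρ M₂ := by
  by_contra! hle
  obtain ⟨x, hx, hx₁, hx₂, hxE⟩ := hx
  have hs : (M₁ ∪ M₂)ᶜ = {s} ∪ ((M₁ ∪ M₂)ᶜ \ {s}) := by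
    rw [Finset.union_sdiff_of_subset]
    simp [h₁.notMem, h₂.notMem]
  have hb := between_union_right E (A := M₁ ∩ M₂) (B := {s}) (C := (M₁ ∪ M₂)ᶜ \ {s})
    (by simp [h₁.notMem])
    (by rw [Finset.disjoint_left]; intro a ha; simp at ha; simp [ha])
    Finset.disjoint_sdiff
  rw [← hs] at hb
  have hsu : 0 < between E (M₁ ∩ M₂) {s} := by
    rw [between_comm]
    exact between_pos_of_mem hu (Finset.mem_inter.2 ⟨h₁.mem, h₂.mem⟩)
  have hd := cutSize_sdiff_add_cutSize_sdiff_le E M₁ M₂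
  have hr₁ := H.req_le (M₁ \ M₂)
  have hr₂ := H.req_le (M₂ \ M₁)
  have hl₁ := h₁.le
  have hl₂ := h₂.le
  have hu₁ := h₁.mem
  have hu₂ := h₂.mem
  have hs₁ := h₁.notMem
  have hs₂ := h₂.notMem
  -- The total slack is two, and the edge `su` counts twice: both differences are tight and `su` is
  -- the only edge from `M₁ ∩ M₂` to outside `M₁ ∪ M₂`.
  have ht₁ : cutSize E (M₁ \ M₂) ≤ req ρ (M₁ \ M₂) := by omega
  have ht₂ : cutSize E (M₂ \ M₁) ≤ req ρ (M₂ \ M₁) := by omega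
  have hN : IsDangerous E ρ s u (M₃ \ (M₂ \ M₁)) := by
    refine ⟨by simp [h₃.notMem], by simp [h₃.mem, hu₁], ?_⟩
    rcases H.uncross h₃.le ht₂ with h | h
    · refine (hmin₂ (M₃ ∪ (M₂ \ M₁)) ⟨?_, ?_, h⟩ ?_).elim
      · simp [h₃.notMem, h₂.notMem]
      · simp [h₃.mem]
      · intro z
        simp
        tauto
    · exact h.1
  have hN' : cutSize E ((M₃ \ (M₂ \ M₁)) \ (M₁ \ M₂)) ≤
      req ρ ((M₃ \ (M₂ \ M₁)) \ (M₁ \ M₂)) + 1 := by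
    rcases H.uncross hN.le ht₁ with h | h
    · refine (hmin₁ _ ⟨?_, ?_, h⟩ ?_).elim
      · simp [h₃.notMem, h₁.notMem]
      · simp [h₃.mem, hu₁]
      · intro z
        simp
        tauto
    · exact h.1
  -- What is left of `M₃` falls into two parts with no edge between them, one containing `u` and the
  -- other `x`; such a set has slack at least two.
  have he : (M₃ \ (M₂ \ M₁)) \ (M₁ \ M₂) = (M₃ ∩ (M₁ ∩ M₂)) ∪ (M₃ \ (M₁ ∪ M₂)) := by
    ext z
    simp
    tauto
  rw [he] at hN'
  have hz : between E (M₃ ∩ (M₁ ∩ M₂)) (M₃ \ (M₁ ∪ M₂)) ≤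
      between E (M₁ ∩ M₂) ((M₁ ∪ M₂)ᶜ \ {s}) := by
    refine between_mono E Finset.inter_subset_right fun z hz => ?_
    simp only [Finset.mem_sdiff, Finset.mem_compl, Finset.mem_singleton] at hz ⊢
    exact ⟨hz.2, fun h => h₃.notMem (h ▸ hz.1)⟩
  have := H.req_add_two_le (P := M₃ ∩ (M₁ ∩ M₂)) (Q := M₃ \ (M₁ ∪ M₂))
    (by rw [Finset.disjoint_left]; intro a ha; simp at ha; simp [ha])
    (by omega)
    (cutSize_pos_of_mem hu (by simp [h₃.mem, h₁.mem, h₂.mem]) (by simp [h₃.notMem]))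
    (cutSize_pos_of_mem hxE (by simp [hx, hx₁, hx₂]) (by simp [h₃.notMem]))
  omega

/-- A family of dangerous sets covering the neighbours of `s` cannot be a sunflower with tight
kernel in which all petals but one have a smaller requirement. -/
theorem false_of_sunflower (H : IsSplitReady E ρ s) {F : Finset (Finset W)} {T M₀ : Finset W}
    (hF : ∀ M ∈ F, IsDangerous E ρ s u M) (hT : ∀ M ∈ F, ∀ M' ∈ F, M ≠ M' → M ∩ M' = T)
    (hTle : cutSize E T ≤ req ρ T) (hu : s(s, u) ∈ E) (huT : u ∈ T)
    (hcov : ∀ x ≠ s, s(s, x) ∈ E → ∃ M ∈ F, x ∈ M)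
    (hpriv : ∀ M ∈ F, ∃ x ∈ M \ T, s(s, x) ∈ E) (hcard : 3 ≤ F.card) (h₀ : M₀ ∈ F)
    (hlt : ∀ M ∈ F, M ≠ M₀ → req ρ (M \ T) < req ρ M) : False := by
  have hTM : ∀ M ∈ F, T ⊆ M := by
    intro M hM
    obtain ⟨M', hM', hne⟩ := Finset.exists_mem_ne (by omega : 1 < F.card) M
    rw [← hT M hM M' hM' hne.symm]
    exact Finset.inter_subset_left
  have hsT : s ∉ T := fun h => (hF _ h₀).notMem (hTM _ h₀ h)
  have hT2 := H.two_le T (cutSize_pos_of_mem hu huT hsT)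
  have hTr := H.req_le T
  obtain ⟨x₀, hx₀, y₀, hy₀, hxy₀⟩ := exists_req_eq (ρ := ρ) (X := T) (by omega)
  -- Otherwise the petal `M \ T` would separate `x₀` from `y₀`, so its requirement would be at least
  -- that of `T`, hence at least that of `M`.
  have hy₀M : ∀ M ∈ F, M ≠ M₀ → y₀ ∉ M := by
    intro M hM hne hy
    have h1 := hlt M hM hne
    obtain ⟨i, hi, j, hj, he⟩ := exists_req_eq (ρ := ρ) (X := M) (by omega)
    have h2 := @le_req _ _ _ _ H.symm (M \ T) x₀ y₀ (by simp [hx₀, hy₀, hy])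
    by_cases hiT : i ∈ T
    · have h3 := @le_req _ _ _ _ H.symm T i j (by have := @hTM M hM j; tauto)
      omega
    · have h3 := @le_req _ _ _ _ H.symm (M \ T) i j (by simp [hi, hj, hiT])
      omega
  have hreq : ∀ M ∈ F, M ≠ M₀ → req ρ M ≤ req ρ T ∧ cutSize E M ≤ cutSize E T + 1 := by
    intro M hM hne
    have h1 := hlt M hM hne
    have h4 := (hF M hM).le
    obtain ⟨i, hi, j, hj, he⟩ := exists_req_eq (ρ := ρ) (X := M) (by omega)
    by_cases hiT : i ∈ T
    · have h3 := @le_req _ _ _ _ H.symm T i j (by have := @hTM M hM j; tauto)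
      omega
    · have h3 := @le_req _ _ _ _ H.symm (M \ T) i j (by simp [hi, hj, hiT])
      omega
  -- By submodularity each added member enlarges the cut by at most one, and its private neighbour
  -- of `s` adds at least one edge from `s`.
  have hunion : ∀ J ⊆ F.erase M₀, cutSize E (M₀ ∪ J.sup id) + between E {s} M₀ ≤
      cutSize E M₀ + between E {s} (M₀ ∪ J.sup id) := by
    intro J
    induction J using Finset.induction_on with
    | empty => simp
    | insert M J hMJ ih =>
      intro hJ
      have ih := ih ((Finset.subset_insert _ _).trans hJ)
      have hM := Finset.mem_erase.1 (hJ (Finset.mem_insert_self _ _))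
      have hinter : (M₀ ∪ J.sup id) ∩ M = T := by
        apply le_antisymm
        · intro z hz
          simp only [Finset.mem_inter, Finset.mem_union, Finset.mem_sup, id] at hz
          rcases hz with ⟨hz | ⟨M', hM', hz⟩, hzM⟩
          · rw [← hT M₀ h₀ M hM.2 hM.1.symm]
            exact Finset.mem_inter.2 ⟨hz, hzM⟩
          · rw [← hT M' (Finset.mem_erase.1 (hJ (Finset.mem_insert_of_mem hM'))).2 M hM.2
              (fun h => hMJ (h ▸ hM'))]
            exact Finset.mem_inter.2 ⟨hz, hzM⟩
        · exact Finset.subset_inter ((hTM _ h₀).trans Finset.subset_union_left) (hTM _ hM.2)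
      have hun : M₀ ∪ (insert M J).sup id = (M₀ ∪ J.sup id) ∪ M := by
        rw [Finset.sup_insert, id, Finset.sup_eq_union, Finset.union_assoc,
          Finset.union_comm M]
      have hun' : (M₀ ∪ J.sup id) ∪ M = (M₀ ∪ J.sup id) ∪ (M \ T) := by
        rw [← hinter]
        ext z
        simp only [Finset.mem_union, Finset.mem_sdiff, Finset.mem_inter]
        tauto
      have hdis : Disjoint (M₀ ∪ J.sup id) (M \ T) := by
        rw [← hinter, Finset.disjoint_left]
        intro z hz
        simp only [Finset.mem_sdiff, Finset.mem_inter]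
        tauto
      have hsJ : s ∉ M₀ ∪ J.sup id := by
        simp only [Finset.mem_union, Finset.mem_sup, id, not_or, not_exists, not_and]
        exact ⟨(hF _ h₀).notMem, fun M' hM' =>
          (hF _ (Finset.mem_erase.1 (hJ (Finset.mem_insert_of_mem hM'))).2).notMem⟩
      have hsM : s ∉ M \ T := by simp [(hF _ hM.2).notMem]
      have h1 := cutSize_inter_add_cutSize_union_le E (M₀ ∪ J.sup id) M
      rw [hinter] at h1
      have h2 := between_union_right E (A := {s}) (by simpa using hsJ) (by simpa using hsM) hdis
      obtain ⟨x, hx, hxE⟩ := hpriv M hM.2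
      have h3 := between_pos_of_mem hxE hx
      have h4 := (hreq M hM.2 hM.1).2
      rw [hun, hun', h2, ← hun']
      omega
  have hU := hunion _ subset_rfl
  set U := M₀ ∪ (F.erase M₀).sup id with hUdef
  have hmemU : ∀ z, z ∈ U ↔ ∃ M ∈ F, z ∈ M := by
    intro z
    simp only [hUdef, Finset.mem_union, Finset.mem_sup, id, Finset.mem_erase]
    constructor
    · rintro (h | ⟨M, hM, h⟩)
      · exact ⟨_, h₀, h⟩
      · exact ⟨M, hM.2, h⟩
    · rintro ⟨M, hM, h⟩
      by_cases hne : M = M₀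
      · exact Or.inl (hne ▸ h)
      · exact Or.inr ⟨M, ⟨hne, hM⟩, h⟩
  have hsU : s ∉ U := by
    rw [hmemU]
    rintro ⟨M, hM, h⟩
    exact (hF M hM).notMem h
  have hn0 : between E {s} (insert s U)ᶜ = 0 := by
    by_contra h
    obtain ⟨a, ha, x, hx, hE⟩ := (between_pos_iff E _ _).1 (Nat.pos_of_ne_zero h)
    rw [Finset.mem_singleton] at ha
    subst ha
    simp only [Finset.mem_compl, Finset.mem_insert, not_or] at hx
    exact hx.2 ((hmemU x).2 (hcov x hx.1 hE))
  have hcU := cutSize_compl_insert E hsU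
  have hrU := H.req_le_cutSize_compl_insert U
  have hn2 : 2 ≤ between E {s} M₀ := by
    obtain ⟨x, hx, hxE⟩ := hpriv M₀ h₀
    have h1 := between_pos_of_mem hu huT
    have h2 := between_pos_of_mem hxE hx
    have h3 := between_union_right E (A := {s}) (by simpa using hsT)
      (by simp [(hF _ h₀).notMem]) (Finset.disjoint_sdiff (s := T) (t := M₀))
    rw [Finset.union_sdiff_of_subset (hTM _ h₀)] at h3
    omega
  have hd₀ := (hF _ h₀).le
  have hd₀' := H.two_le M₀ (cutSize_pos_of_mem hu (hTM _ h₀ huT) (hF _ h₀).notMem)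
  obtain ⟨x₁, hx₁, y₁, hy₁, hxy₁⟩ := exists_req_eq (ρ := ρ) (X := M₀) (by omega)
  have hx₁U : x₁ ∈ U := (hmemU _).2 ⟨_, h₀, hx₁⟩
  -- The complement of `U` without `s` has cut at most `req ρ M₀ - 1`, so `U` cannot separate `x₁`
  -- from `y₁`.
  by_cases hy₁U : y₁ ∈ U
  · obtain ⟨M, hM, hyM⟩ := (hmemU _).1 hy₁U
    have hne : M ≠ M₀ := fun h => hy₁ (h ▸ hyM)
    have hy₁T : y₁ ∉ T := fun h => hy₁ (hTM _ h₀ h)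
    have hx₁M : x₁ ∉ M \ T := by
      rw [← hT M hM M₀ h₀ hne]
      simp [hx₁]
    have hr₁ := @le_req _ _ _ _ H.symm (M \ T) x₁ y₁ (by simp [hx₁M, hyM, hy₁T])
    have hlt' := hlt M hM hne
    have hMT := (hreq M hM hne).1
    have hMT' := (hreq M hM hne).2
    have hy₀' : y₀ ∈ M₀ \ T := by
      by_contra h
      have := @le_req _ _ _ _ H.symm M₀ x₀ y₀ (by
        have := hTM _ h₀ hx₀
        simp [hy₀] at h
        simp [this, h])
      omega
    have hr₂ := @le_req _ _ _ _ H.symm (M₀ \ T) x₀ y₀ (by simp [hx₀, hy₀'])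
    have hr₃ := H.req_le (M₀ \ T)
    have hr₄ := H.req_le (M \ T)
    have hc₀ := cutSize_union_add E (Finset.disjoint_sdiff (s := T) (t := M₀))
    have hc := cutSize_union_add E (Finset.disjoint_sdiff (s := T) (t := M))
    rw [Finset.union_sdiff_of_subset (hTM _ h₀)] at hc₀
    rw [Finset.union_sdiff_of_subset (hTM _ hM)] at hc
    obtain ⟨M', hM', hne', hne₀⟩ : ∃ M' ∈ F, M' ≠ M ∧ M' ≠ M₀ := by
      obtain ⟨M', hM', h⟩ := Finset.exists_mem_notMem_of_card_lt_card
        (s := {M, M₀}) (t := F) (Finset.card_le_two.trans_lt (by omega))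
      simp only [Finset.mem_insert, Finset.mem_singleton, not_or] at h
      exact ⟨M', hM', h⟩
    have hc' := cutSize_union_add E (Finset.disjoint_sdiff (s := T) (t := M'))
    rw [Finset.union_sdiff_of_subset (hTM _ hM')] at hc'
    have hMT'' := (hreq M' hM' hne₀).2
    obtain ⟨x', hx', hx'E⟩ := hpriv M' hM'
    have h2 := H.two_le (M' \ T) (cutSize_pos_of_mem hx'E hx' (by simp [(hF _ hM').notMem]))
    have hdisj : ∀ A ∈ F, ∀ B ∈ F, A ≠ B → Disjoint (A \ T) (B \ T) := by
      intro A hA B hB hAB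
      rw [← hT A hA B hB hAB, Finset.disjoint_left]
      intro z
      simp
      tauto
    -- Let `t` be the cut size of `T`. The petals of `M₀` and `M` together receive at least `t - 1`
    -- edges from `T`; the third petal and `s` each receive at least one: too many.
    have hsub : between E T ((M₀ \ T) ∪ ((M \ T) ∪ ((M' \ T) ∪ {s}))) ≤ cutSize E T := by
      apply between_le_cutSize
      rw [Finset.disjoint_left]
      intro z hz
      have : z ≠ s := fun h => hsT (h ▸ hz)
      simp [hz, this]
    have hd1 := hdisj M₀ h₀ M hM hne.symm
    have hd2 := hdisj M₀ h₀ M' hM' hne₀.symm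
    have hd3 := hdisj M hM M' hM' hne'.symm
    have hd4 : ∀ A ∈ F, Disjoint (A \ T) {s} := fun A hA => by simp [(hF _ hA).notMem]
    have hd5 : ∀ A ∈ F, Disjoint T (A \ T) := fun A hA => Finset.disjoint_sdiff
    have hd6 : Disjoint T {s} := by simpa using hsT
    rw [between_union_right E (hd5 _ h₀), between_union_right E (hd5 _ hM),
      between_union_right E (hd5 _ hM') hd6 (hd4 _ hM')] at hsub
    · have := between_pos_of_mem hu huT
      rw [between_comm] at this
      omega
    · simp only [Finset.disjoint_union_right]
      exact ⟨hd5 _ hM', hd6⟩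
    · simp only [Finset.disjoint_union_right]
      exact ⟨hd3, hd4 _ hM⟩
    · simp only [Finset.disjoint_union_right]
      exact ⟨hd5 _ hM, hd5 _ hM', hd6⟩
    · simp only [Finset.disjoint_union_right]
      exact ⟨hd1, hd2, hd4 _ h₀⟩
  · have := @le_req _ _ _ _ H.symm U x₁ y₁ (by simp [hx₁U, hy₁U])
    omega

end IsSplitReady

end Splitting

/-! ### Existence of splittings and complete splitting off -/

section Elimination

variable {W : Type*} [Fintype W] [DecidableEq W] {E : Multiset (Sym2 W)} {ρ : W → W → ℕ} {s u : W}

namespace IsSplitReady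

/-- Maximal dangerous sets containing `u` cannot cover the neighbours of `s`. -/
theorem not_covered (H : IsSplitReady E ρ s) (hu : s(s, u) ∈ E) (hus : u ≠ s) :
    ¬ ∀ x ≠ s, s(s, x) ∈ E → ∃ M, IsDangerous E ρ s u M ∧ x ∈ M := by
  classical
  intro hall
  have hext : ∀ M, IsDangerous E ρ s u M → ∃ D, M ⊆ D ∧ Maximal (IsDangerous E ρ s u) D := by
    intro M hM
    obtain ⟨D, hD, hmax⟩ := (Set.toFinite {D | IsDangerous E ρ s u D}).exists_le_maximal hM
    exact ⟨D, hD, hmax⟩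
  let C : Finset (Finset (Finset W)) := Finset.univ.filter fun F =>
    (∀ M ∈ F, Maximal (IsDangerous E ρ s u) M) ∧ ∀ x ≠ s, s(s, x) ∈ E → ∃ M ∈ F, x ∈ M
  have hC : C.Nonempty := by
    refine ⟨Finset.univ.filter (Maximal (IsDangerous E ρ s u)), ?_⟩
    simp only [C, Finset.mem_filter, Finset.mem_univ, true_and, imp_self, implies_true]
    intro x hx hxE
    obtain ⟨M, hM, hxM⟩ := hall x hx hxE
    obtain ⟨D, hMD, hD⟩ := hext M hM
    exact ⟨D, hD, hMD hxM⟩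
  obtain ⟨F, hFC, hFmin⟩ := C.exists_min_image Finset.card hC
  simp only [C, Finset.mem_filter, Finset.mem_univ, true_and] at hFC hFmin
  obtain ⟨hFmax, hcov⟩ := hFC
  have hFd : ∀ M ∈ F, IsDangerous E ρ s u M := fun M hM => (hFmax M hM).prop
  have hpriv : ∀ M ∈ F, ∃ x ∈ M, s(s, x) ∈ E ∧ x ≠ s ∧ ∀ M' ∈ F, M' ≠ M → x ∉ M' := by
    intro M hM
    by_contra! hno
    have := hFmin (F.erase M) ⟨fun M' hM' => hFmax M' (Finset.mem_of_mem_erase hM'), ?_⟩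
    · have h1 := Finset.card_erase_lt_of_mem hM
      omega
    · intro x hx hxE
      obtain ⟨M', hM', hxM'⟩ := hcov x hx hxE
      by_cases hne : M' = M
      · subst hne
        obtain ⟨M'', hM'', hne'', h⟩ := hno x hxM' hxE hx
        exact ⟨M'', Finset.mem_erase.2 ⟨hne'', hM''⟩, h⟩
      · exact ⟨M', Finset.mem_erase.2 ⟨hne, hM'⟩, hxM'⟩
  -- Otherwise a maximal dangerous set above `D` could replace both `M₁` and `M₂`, giving a smaller
  -- cover.
  have hmin : ∀ M₁ ∈ F, ∀ M₂ ∈ F, ∀ M₃ ∈ F, M₁ ≠ M₂ → M₃ ≠ M₁ → M₃ ≠ M₂ →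
      ∀ D, IsDangerous E ρ s u D → ¬ M₁ ∪ M₂ ⊆ D ∪ M₃ := by
    intro M₁ h₁ M₂ h₂ M₃ h₃ h₁₂ h₃₁ h₃₂ D hD hsub
    obtain ⟨D', hDD', hD'⟩ := hext D hD
    have hc := hFmin (insert D' ((F.erase M₁).erase M₂)) ⟨?_, ?_⟩
    · have h1 := Finset.card_insert_le D' ((F.erase M₁).erase M₂)
      have h2 := Finset.card_erase_add_one h₁
      have h3 := Finset.card_erase_add_one (Finset.mem_erase.2 ⟨h₁₂.symm, h₂⟩)
      omega
    · intro M hM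
      rcases Finset.mem_insert.1 hM with rfl | hM
      · exact hD'
      · exact hFmax M (Finset.mem_of_mem_erase (Finset.mem_of_mem_erase hM))
    · intro x hx hxE
      obtain ⟨M, hM, hxM⟩ := hcov x hx hxE
      by_cases hxs : x ∈ M₁ ∪ M₂
      · rcases Finset.mem_union.1 (hsub hxs) with h | h
        · exact ⟨D', Finset.mem_insert_self _ _, hDD' h⟩
        · exact ⟨M₃, by simp [h₃, h₃₁, h₃₂], h⟩
      · refine ⟨M, ?_, hxM⟩
        have hM₁ : M ≠ M₁ := fun h => hxs (by simp [← h, hxM])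
        have hM₂ : M ≠ M₂ := fun h => hxs (by simp [← h, hxM])
        simp [hM, hM₁, hM₂]
  have hcovle : ∀ X, s ∉ X → (∀ x ≠ s, s(s, x) ∈ E → x ∈ X) →
      between E {s} X = cutSize E {s} := by
    intro X hsX hX
    rw [← between_add_between_compl E hsX]
    have : between E {s} (insert s X)ᶜ = 0 := by
      by_contra h
      obtain ⟨a, ha, x, hx, hE⟩ := (between_pos_iff E _ _).1 (Nat.pos_of_ne_zero h)
      rw [Finset.mem_singleton] at ha
      subst ha
      simp only [Finset.mem_compl, Finset.mem_insert, not_or] at hx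
      exact hx.2 (hX x hx.1 hE)
    omega
  have hdpos : 0 < cutSize E {s} :=
    (between_pos_iff E _ _).2 ⟨s, by simp, u, by simpa using hus, hu⟩
  -- Each member receives at most half of the edges at `s`, and two members share the edge `su`.
  have hcard : 3 ≤ F.card := by
    by_contra! hlt
    obtain ⟨M₁, h₁, hu₁⟩ := hcov u hus hu
    have hle₁ := H.two_mul_between_le (hFd _ h₁)
    by_cases hF : F = {M₁}
    · have := hcovle M₁ (hFd _ h₁).notMem fun x hx hxE => by
        simpa [hF] using hcov x hx hxE
      omega
    · obtain ⟨M₂, h₂, hne⟩ : ∃ M₂ ∈ F, M₂ ≠ M₁ := by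
        by_contra! h
        exact hF (Finset.eq_singleton_iff_unique_mem.2 ⟨h₁, h⟩)
      have hF2 : F = {M₁, M₂} := by
        symm
        apply Finset.eq_of_subset_of_card_le
        · intro M hM
          rcases Finset.mem_insert.1 hM with rfl | hM
          · exact h₁
          · exact Finset.mem_singleton.1 hM ▸ h₂
        · rw [Finset.card_pair hne.symm]
          omega
      have hle₂ := H.two_mul_between_le (hFd _ h₂)
      have hs₁ := (hFd _ h₁).notMem
      have hs₂ := (hFd _ h₂).notMem
      have hun := hcovle (M₁ ∪ M₂) (by simp [hs₁, hs₂]) fun x hx hxE => by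
        simpa [hF2] using hcov x hx hxE
      have h3 := between_union_right E (A := {s}) (B := M₁ ∩ M₂) (C := M₁ \ M₂)
        (by simp [hs₁]) (by simp [hs₁])
        (by rw [Finset.disjoint_left]; intro a ha; simp at ha; simp [ha])
      have h4 := between_union_right E (A := {s}) (B := M₁ \ M₂) (C := M₂)
        (by simp [hs₁]) (by simp [hs₂]) Finset.sdiff_disjoint
      have h5 : M₁ ∩ M₂ ∪ M₁ \ M₂ = M₁ := by ext z; simp; tauto
      have h6 : M₁ \ M₂ ∪ M₂ = M₁ ∪ M₂ := by ext z; simp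
      have h7 := between_pos_of_mem hu (Finset.mem_inter.2 ⟨(hFd _ h₁).mem, (hFd _ h₂).mem⟩)
      rw [h5] at h3
      rw [h6] at h4
      omega
  have hthird : ∀ M₁ M₂, ∃ M₃ ∈ F, M₃ ≠ M₁ ∧ M₃ ≠ M₂ := by
    intro M₁ M₂
    obtain ⟨M, hM, h⟩ := Finset.exists_mem_notMem_of_card_lt_card
      (s := {M₁, M₂}) (t := F) (Finset.card_le_two.trans_lt (by omega))
    simp only [Finset.mem_insert, Finset.mem_singleton, not_or] at h
    exact ⟨M, hM, h⟩
  have hlt : ∀ M₁ ∈ F, ∀ M₂ ∈ F, M₁ ≠ M₂ →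
      req ρ (M₁ \ M₂) + req ρ (M₂ \ M₁) < req ρ M₁ + req ρ M₂ := by
    intro M₁ h₁ M₂ h₂ h₁₂
    obtain ⟨M₃, h₃, h₃₁, h₃₂⟩ := hthird M₁ M₂
    obtain ⟨x, hx, hxE, -, hx'⟩ := hpriv M₃ h₃
    exact H.req_sdiff_add_req_sdiff_lt hu (hFd _ h₁) (hFd _ h₂) (hFd _ h₃)
      ⟨x, hx, hx' _ h₁ h₃₁.symm, hx' _ h₂ h₃₂.symm, hxE⟩
      (hmin M₁ h₁ M₃ h₃ M₂ h₂ h₃₁.symm h₁₂.symm h₃₂.symm)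
      (hmin M₂ h₂ M₃ h₃ M₁ h₁ h₃₂.symm h₁₂ h₃₁.symm)
  have htight : ∀ M₁ ∈ F, ∀ M₂ ∈ F, M₁ ≠ M₂ → cutSize E (M₁ ∩ M₂) ≤ req ρ (M₁ ∩ M₂) := by
    intro M₁ h₁ M₂ h₂ h₁₂
    obtain ⟨M₃, h₃, h₃₁, h₃₂⟩ := hthird M₁ M₂
    have hd₁ := hFd _ h₁
    have hd₂ := hFd _ h₂
    have hnot : ¬ cutSize E (M₁ ∪ M₂) ≤ req ρ (M₁ ∪ M₂) + 1 := fun h =>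
      hmin M₁ h₁ M₂ h₂ M₃ h₃ h₁₂ h₃₁ h₃₂ (M₁ ∪ M₂)
        ⟨by simp [hd₁.notMem, hd₂.notMem], by simp [hd₁.mem], h⟩ Finset.subset_union_left
    have h1 := cutSize_inter_add_cutSize_union_le E M₁ M₂
    have h2 := hd₁.le
    have h3 := hd₂.le
    have h4 := hlt M₁ h₁ M₂ h₂ h₁₂
    rcases req_skew_supermodular H.symm M₁ M₂ with h | h <;> omega
  have hinter : ∀ M₁ ∈ F, ∀ M₂ ∈ F, M₁ ≠ M₂ → ∀ M ∈ F, M₁ ∩ M₂ ⊆ M := by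
    intro M₁ h₁ M₂ h₂ h₁₂ M hM
    have hd₁ := hFd _ h₁
    have hd₂ := hFd _ h₂
    have hd := hFd _ hM
    have hdan : IsDangerous E ρ s u (M ∪ (M₁ ∩ M₂)) := by
      refine ⟨by simp [hd.notMem, hd₁.notMem], by simp [hd.mem], ?_⟩
      rcases H.uncross hd.le (htight M₁ h₁ M₂ h₂ h₁₂) with h | h
      · exact h
      · have : 0 < between E (M ∩ (M₁ ∩ M₂)) (M ∪ M₁ ∩ M₂)ᶜ :=
          (between_pos_iff E _ _).2 ⟨u, by simp [hd.mem, hd₁.mem, hd₂.mem], s,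
            by simp [hd.notMem, hd₁.notMem], Sym2.eq_swap ▸ hu⟩
        omega
    exact Finset.subset_union_right.trans
      ((hFmax M hM).le_of_ge hdan Finset.subset_union_left)
  obtain ⟨A, hA, B, hB, hAB⟩ := Finset.one_lt_card.1 (by omega : 1 < F.card)
  have hT : ∀ M ∈ F, ∀ M' ∈ F, M ≠ M' → M ∩ M' = A ∩ B := by
    intro M hM M' hM' hne
    exact le_antisymm
      (Finset.subset_inter (hinter M hM M' hM' hne A hA) (hinter M hM M' hM' hne B hB))
      (Finset.subset_inter (hinter A hA B hB hAB M hM) (hinter A hA B hB hAB M' hM'))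
  have hsdiff : ∀ M ∈ F, ∀ M' ∈ F, M ≠ M' → M \ M' = M \ (A ∩ B) := by
    intro M hM M' hM' hne
    rw [← hT M hM M' hM' hne, Finset.sdiff_inter_self_left]
  -- By `hlt`, at most one member can violate the inequality; it becomes `M₀`.
  obtain ⟨M₀, h₀, hM₀⟩ : ∃ M₀ ∈ F, ∀ M ∈ F, M ≠ M₀ → req ρ (M \ (A ∩ B)) < req ρ M := by
    by_cases hex : ∃ M₀ ∈ F, req ρ M₀ ≤ req ρ (M₀ \ (A ∩ B))
    · obtain ⟨M₀, h₀, hle⟩ := hex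
      refine ⟨M₀, h₀, fun M hM hne => ?_⟩
      have := hlt M hM M₀ h₀ hne
      rw [hsdiff M hM M₀ h₀ hne, hsdiff M₀ h₀ M hM hne.symm] at this
      omega
    · push Not at hex
      exact ⟨A, hA, fun M hM _ => hex M hM⟩
  refine H.false_of_sunflower hFd hT (htight A hA B hB hAB) hu
    (Finset.mem_inter.2 ⟨(hFd A hA).mem, (hFd B hB).mem⟩) hcov (fun M hM => ?_) hcard h₀ hM₀
  obtain ⟨x, hx, hxE, -, hx'⟩ := hpriv M hM
  obtain ⟨M', hM', hne, -⟩ := hthird M M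
  refine ⟨x, ?_, hxE⟩
  rw [← hT M hM M' hM' hne.symm]
  simp [hx, hx' M' hM' hne]

theorem exists_not_dangerous (H : IsSplitReady E ρ s) (hu : s(s, u) ∈ E) (hus : u ≠ s) :
    ∃ x ≠ s, s(s, x) ∈ E.erase s(s, u) ∧ ∀ M, IsDangerous E ρ s u M → x ∉ M := by
  by_contra! hno
  refine H.not_covered hu hus fun x hx hxE => ?_
  by_cases hxu : x = u
  -- Even degree yields a second edge at `s`; the dangerous set that blocks it contains `u` as well.
  · subst hxu
    have he := H.even
    rw [← Multiset.cons_erase hu, cutSize_cons, joins_mk, if_pos (by simp [hus]),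
      Nat.even_iff] at he
    obtain ⟨a, ha, z, hz, hE⟩ := (between_pos_iff (E.erase s(s, x)) {s} {s}ᶜ).1
      (by change 0 < cutSize _ _; omega)
    rw [Finset.mem_singleton] at ha
    subst ha
    obtain ⟨M, hM, -⟩ := hno z (by simpa using hz) hE
    exact ⟨M, hM, hM.mem⟩
  · refine hno x hx ((Multiset.mem_erase_of_ne fun h => hxu ?_).2 hxE)
    simpa [hx] using h

/-- Splitting off a suitable pair of edges at `s` preserves the requirement. -/
theorem exists_split (H : IsSplitReady E ρ s) (hpos : 0 < cutSize E {s}) :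
    ∃ u x : W, ∃ E' : Multiset (Sym2 W), E = s(s, u) ::ₘ s(s, x) ::ₘ E' ∧
      ∀ X, req ρ X ≤ cutSize (s(u, x) ::ₘ E') X := by
  obtain ⟨a, ha, u, hu, hE⟩ := (between_pos_iff E _ _).1 hpos
  rw [Finset.mem_singleton] at ha
  subst ha
  have hus : u ≠ a := by simpa using hu
  obtain ⟨x, hx, hxE, hnot⟩ := H.exists_not_dangerous hE hus
  have hEE : E = s(a, u) ::ₘ s(a, x) ::ₘ (E.erase s(a, u)).erase s(a, x) := by
    rw [Multiset.cons_erase hxE, Multiset.cons_erase hE]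
  refine ⟨u, x, _, hEE, ?_⟩
  generalize (E.erase s(a, u)).erase s(a, x) = E' at hEE
  have key : ∀ X, a ∉ X → req ρ X ≤ cutSize (s(u, x) ::ₘ E') X := by
    intro X haX
    have h1 := H.req_le X
    have h2 : cutSize E X = joins X Xᶜ s(a, u) + (joins X Xᶜ s(a, x) + cutSize E' X) := by
      rw [hEE, cutSize_cons, cutSize_cons]
    rw [cutSize_cons]
    have h3 : u ∈ X → x ∈ X → req ρ X + 2 ≤ cutSize E X := by
      intro huX hxX
      by_contra h
      exact hnot X ⟨haX, huX, by omega⟩ hxX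
    simp only [joins_mk, Finset.mem_compl] at *
    by_cases huX : u ∈ X <;> by_cases hxX : x ∈ X <;> simp_all <;> omega
  intro X
  by_cases haX : a ∈ X
  · rw [← req_compl H.symm, ← cutSize_compl]
    exact key _ (by simpa using haX)
  · exact key _ haX

end IsSplitReady

/-- Complete splitting off: all edges at nodes outside `V` can be replaced by edges inside `V`
without violating the requirement and without increasing a metric cost. -/
theorem exists_eliminated (V : Set W) (D : Sym2 W → ℝ)
    (hD : ∀ a b c, D s(b, c) ≤ D s(a, b) + D s(a, c)) (hρ : ∀ i j, ρ i j = ρ j i)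
    (hρ0 : ∀ i ∉ V, ∀ j, ρ i j = 0) (hρ2 : ∀ i ∈ V, ∀ j ∈ V, i ≠ j → 2 ≤ ρ i j)
    (E : Multiset (Sym2 W)) (heven : ∀ w ∉ V, Even (cutSize E {w}))
    (hreq : ∀ X, req ρ X ≤ cutSize E X) :
    ∃ E' : Multiset (Sym2 W), (∀ w ∉ V, cutSize E' {w} = 0) ∧ (∀ X, req ρ X ≤ cutSize E' X) ∧
      (E'.map D).sum ≤ (E.map D).sum := by
  induction hn : E.card using Nat.strong_induction_on generalizing E with
  | _ n ih =>
    by_cases hdone : ∀ w ∉ V, cutSize E {w} = 0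
    · exact ⟨E, hdone, hreq, le_rfl⟩
    push Not at hdone
    obtain ⟨s, hs, hpos⟩ := hdone
    -- Either `A` separates two nodes of `V`, or one side avoids `V` and the cut is even.
    have htwo : ∀ A : Finset W, 0 < cutSize E A → 2 ≤ cutSize E A := by
      intro A hA
      by_cases h1 : ∃ i ∈ A, i ∈ V
      · by_cases h2 : ∃ j ∉ A, j ∈ V
        · obtain ⟨i, hi, hiV⟩ := h1
          obtain ⟨j, hj, hjV⟩ := h2
          calc 2 ≤ ρ i j := hρ2 i hiV j hjV fun h => hj (h ▸ hi)
            _ ≤ req ρ A := le_req hρ (by tauto)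
            _ ≤ cutSize E A := hreq A
        · push Not at h2
          have := even_cutSize E Aᶜ fun w hw => heven w (h2 w (by simpa using hw))
          rw [cutSize_compl, Nat.even_iff] at this
          omega
      · push Not at h1
        have := even_cutSize E A fun w hw => heven w (h1 w hw)
        rw [Nat.even_iff] at this
        omega
    have H : IsSplitReady E ρ s := ⟨hρ, hreq, hρ0 s hs, heven s hs, htwo⟩
    obtain ⟨u, x, E', rfl, hreq'⟩ := H.exists_split (Nat.pos_of_ne_zero hpos)
    have heven' : ∀ w ∉ V, Even (cutSize (s(u, x) ::ₘ E') {w}) := by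
      intro w hw
      have := heven w hw
      simp only [cutSize_cons, joins_mk, Finset.mem_singleton, Finset.mem_compl,
        Nat.even_iff] at this ⊢
      by_cases h1 : s = w <;> by_cases h2 : u = w <;> by_cases h3 : x = w <;>
        simp only [h1, h2, h3, and_true, and_false, or_false, or_true,
          not_true_eq_false, not_false_eq_true, if_true, if_false, or_self, and_self] at this ⊢ <;>
        omega
    obtain ⟨E'', h1, h2, h3⟩ := ih _ (by simp at hn ⊢; omega) (s(u, x) ::ₘ E') heven' hreq' rfl
    refine ⟨E'', h1, h2, h3.trans ?_⟩
    simp only [Multiset.map_cons, Multiset.sum_cons]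
    linarith [hD s u x]

end Elimination

/-! ### Paths and distances in trees -/

section Trees

open SimpleGraph

theorem mem_cut {α : Type*} [Fintype α] {G : SimpleGraph α} {X : Set α} {x y : α} :
    s(x, y) ∈ cut G X ↔ G.Adj x y ∧ ¬(x ∈ X ↔ y ∈ X) := by
  classical
  simp only [cut, Finset.mem_filter, SimpleGraph.mem_edgeFinset, SimpleGraph.mem_edgeSet]
  refine and_congr_right fun _ => ⟨?_, fun h => ?_⟩
  · rintro ⟨a, ha, b, hb, h⟩
    rcases Sym2.eq_iff.1 h with ⟨rfl, rfl⟩ | ⟨rfl, rfl⟩ <;> tauto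
  · by_cases hx : x ∈ X
    · exact ⟨x, hx, y, by tauto, rfl⟩
    · exact ⟨y, by tauto, x, hx, Sym2.eq_swap⟩

variable {W : Type*} {T : SimpleGraph W}

/-- A walk that uses the deleted edge reaches one of its ends just before the first use. -/
theorem reachable_deleteEdges_or {a b x y : W} (p : T.Walk x y)
    (hy : (T.deleteEdges {s(a, b)}).Reachable y a ∨ (T.deleteEdges {s(a, b)}).Reachable y b) :
    (T.deleteEdges {s(a, b)}).Reachable x a ∨ (T.deleteEdges {s(a, b)}).Reachable x b := by
  induction p with
  | nil => exact hy
  | @cons x z y hxz q ih =>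
    by_cases h : s(x, z) = s(a, b)
    · rcases Sym2.eq_iff.1 h with ⟨rfl, rfl⟩ | ⟨rfl, rfl⟩
      · exact Or.inl (Reachable.refl _)
      · exact Or.inr (Reachable.refl _)
    · have hadj : (T.deleteEdges {s(a, b)}).Reachable x z :=
        Adj.reachable (by simpa [deleteEdges_adj] using ⟨hxz, by simpa using h⟩)
      exact (ih hy).imp hadj.trans hadj.trans

/-- In a tree, the path between `i` and `j` uses exactly the edges separating `i` from `j`. -/
theorem mem_edges_iff_separates (hT : T.IsTree) (v : W) {i j : W} {p : T.Walk i j} (hp : p.IsPath)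
    {e : Sym2 W} :
    e ∈ p.edges ↔ e ∈ T.edgeSet ∧
      ¬((T.deleteEdges {e}).Reachable v i ↔ (T.deleteEdges {e}).Reachable v j) := by
  classical
  have hreach : (T.deleteEdges {e}).Reachable i j ↔ e ∉ p.edges := by
    constructor
    · rintro ⟨q⟩
      have hq : e ∉ (q.mapLe (T.deleteEdges_le {e})).bypass.edges := by
        intro h
        have h1 := (q.mapLe (T.deleteEdges_le {e})).edges_bypass_subset_edges h
        rw [Walk.edges_mapLe_eq_edges] at h1
        have h2 := q.edges_subset_edgeSet h1
        simp [edgeSet_deleteEdges] at h2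
      rwa [(hT.existsUnique_path i j).unique hp (Walk.bypass_isPath _)]
    · exact fun h => ⟨p.toDeleteEdge e h⟩
  constructor
  · intro he
    have heT := p.edges_subset_edgeSet he
    refine ⟨heT, fun h => ?_⟩
    have hnot : ¬ (T.deleteEdges {e}).Reachable i j := fun h' => hreach.1 h' he
    by_cases hi : (T.deleteEdges {e}).Reachable v i
    · exact hnot (hi.symm.trans (h.1 hi))
    · have hj : ¬ (T.deleteEdges {e}).Reachable v j := fun hj => hi (h.2 hj)
      induction e with | _ a b
      have hall : ∀ x, (T.deleteEdges {s(a, b)}).Reachable x a ∨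
          (T.deleteEdges {s(a, b)}).Reachable x b := fun x =>
        reachable_deleteEdges_or (hT.connected.preconnected x a).some (Or.inl (Reachable.refl _))
      rcases hall v with h1 | h1 <;> rcases hall i with h2 | h2 <;> rcases hall j with h3 | h3
      all_goals first
        | exact hnot (h2.trans h3.symm)
        | exact hi (h1.trans h2.symm)
        | exact hj (h1.trans h3.symm)
  · rintro ⟨-, h⟩
    by_contra he
    have := hreach.2 he
    exact h ⟨fun h => h.trans this, fun h => h.trans this.symm⟩

/-- The path between two nodes of a tree. -/
noncomputable def treePath (hT : T.IsTree) (i j : W) : T.Walk i j :=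
  (hT.existsUnique_path i j).choose

theorem isPath_treePath (hT : T.IsTree) (i j : W) : (treePath hT i j).IsPath :=
  (hT.existsUnique_path i j).choose_spec.1

theorem eq_treePath (hT : T.IsTree) {i j : W} {p : T.Walk i j} (hp : p.IsPath) :
    p = treePath hT i j :=
  (hT.existsUnique_path i j).unique hp (isPath_treePath hT i j)

/-- The tree metric on all nodes of the tree. -/
noncomputable def treeDist (hT : T.IsTree) (l : Sym2 W → ℝ) : Sym2 W → ℝ :=
  Sym2.lift ⟨fun i j => ((treePath hT i j).edges.map l).sum, fun i j => by
    beta_reduce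
    rw [← eq_treePath hT (isPath_treePath hT j i).reverse, Walk.edges_reverse, List.map_reverse,
      List.sum_reverse]⟩

theorem treeDist_eq (hT : T.IsTree) (l : Sym2 W → ℝ) {i j : W} {p : T.Walk i j} (hp : p.IsPath) :
    treeDist hT l s(i, j) = (p.edges.map l).sum := by
  rw [eq_treePath hT hp]
  rfl

theorem treeDist_of_adj (hT : T.IsTree) (l : Sym2 W → ℝ) {e : Sym2 W} (he : e ∈ T.edgeSet) :
    treeDist hT l e = l e := by
  induction e with | _ i j
  have hadj : T.Adj i j := he
  rw [treeDist_eq hT l (p := hadj.toWalk) (by simp [hadj.ne])]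
  simp

variable {l : Sym2 W → ℝ}

theorem treeDist_nonneg (hT : T.IsTree) (hl : ∀ e ∈ T.edgeSet, 0 ≤ l e) (e : Sym2 W) :
    0 ≤ treeDist hT l e := by
  induction e with | _ i j
  rw [treeDist_eq hT l (isPath_treePath hT i j)]
  refine List.sum_nonneg fun x hx => ?_
  obtain ⟨e, he, rfl⟩ := List.mem_map.1 hx
  exact hl e (Walk.edges_subset_edgeSet _ he)

/-- Shortcutting a walk to a path leaves distinct edges of the walk, and the discarded ones have
nonnegative length. -/
theorem treeDist_le_length (hT : T.IsTree) (hl : ∀ e ∈ T.edgeSet, 0 ≤ l e) {i j : W}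
    (p : T.Walk i j) : treeDist hT l s(i, j) ≤ (p.edges.map l).sum := by
  classical
  rw [treeDist_eq hT l p.bypass_isPath]
  obtain ⟨k, hk, hkp⟩ := List.subperm_of_subset p.bypass_isPath.isTrail.edges_nodup
    p.edges_bypass_subset_edges
  obtain ⟨t, ht⟩ := hkp.exists_perm_append
  rw [← (hk.map l).sum_eq, (ht.map l).sum_eq, List.map_append, List.sum_append, le_add_iff_nonneg_right]
  refine List.sum_nonneg fun x hx => ?_
  obtain ⟨e, he, rfl⟩ := List.mem_map.1 hx
  exact hl e (Walk.edges_subset_edgeSet _ (ht.mem_iff.2 (List.mem_append_right _ he)))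

theorem treeDist_triangle (hT : T.IsTree) (hl : ∀ e ∈ T.edgeSet, 0 ≤ l e) (a b c : W) :
    treeDist hT l s(b, c) ≤ treeDist hT l s(a, b) + treeDist hT l s(a, c) := by
  have h := treeDist_le_length hT hl ((treePath hT a b).reverse.append (treePath hT a c))
  rwa [Walk.edges_append, Walk.edges_reverse, List.map_append, List.sum_append, List.map_reverse,
    List.sum_reverse] at h

end Trees

/-! ### Transfer between realizations and tree capacities -/

section Transfer

open SimpleGraph

theorem le_maxReq {V : Type*} [Fintype V] (r : V → V → ℕ) {X : Set V} {i j : V} (hi : i ∈ X)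
    (hj : j ∉ X) : r i j ≤ maxReq r X := by
  classical
  unfold maxReq
  exact Finset.le_sup (f := fun p : V × V => r p.1 p.2) (b := (i, j)) (by simp [hi, hj])

theorem maxReq_le {V : Type*} [Fintype V] (r : V → V → ℕ) {X : Set V} {k : ℕ}
    (h : ∀ i ∈ X, ∀ j ∉ X, r i j ≤ k) : maxReq r X ≤ k := by
  classical
  unfold maxReq
  refine Finset.sup_le fun p hp => ?_
  simp only [Finset.mem_filter, Finset.mem_univ, true_and] at hp
  exact h _ hp.1 _ hp.2

variable {W : Type*} [Fintype W] {V : Finset W} {T : SimpleGraph W} {l : Sym2 W → ℝ}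
  {a : Sym2 V → ℝ} {r : V → V → ℕ} {v : V}

/-- The load that the capacity `y` induces on the edges of a tree. -/
noncomputable def treeLoad (T : SimpleGraph W) (v : V) (y : Sym2 V → ℕ) (e : Sym2 W) : ℕ :=
  ∑ f ∈ cut (⊤ : SimpleGraph V) (side T v e), y f

omit [Fintype W] in
theorem mem_edges_iff_mem_cut_side (hT : T.IsTree) (v : V) {i j : V} (hij : i ≠ j)
    {p : T.Walk (i : W) (j : W)} (hp : p.IsPath) {e : Sym2 W} :
    e ∈ p.edges ↔ e ∈ T.edgeSet ∧ s(i, j) ∈ cut (⊤ : SimpleGraph V) (side T v e) := by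
  rw [mem_edges_iff_separates hT v hp, mem_cut]
  simp [side, hij]

/-- The load at `w` counts each pair `f`, `y f` times, by the edges at `w` on its path. This number
is even when `w` is not an end of the path. -/
theorem isFeasible_treeLoad (hT : T.IsTree) {y : Sym2 V → ℕ} (hy : IsIntegerRealization r y) :
    IsFeasible T r v (treeLoad T v y) := by
  classical
  constructor
  · intro w hw
    have hcomm : ∑ e ∈ cut T {w}, treeLoad T v y e =
        ∑ f ∈ (⊤ : SimpleGraph V).edgeFinset,
          ∑ e ∈ cut T {w} with f ∈ cut (⊤ : SimpleGraph V) (side T v e), y f := by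
      refine Finset.sum_comm' fun e f => ?_
      induction f with | _ i j
      simp only [Finset.mem_filter, mem_edgeFinset, mem_edgeSet, mem_cut]
      tauto
    rw [hcomm]
    refine Finset.even_sum _ fun f hf => ?_
    induction f with | _ i j
    have hij : i ≠ j := by simpa using hf
    rw [Finset.sum_const, smul_eq_mul]
    refine Even.mul_right ?_ _
    have hp := isPath_treePath hT (i : W) j
    have heq : (cut T {w}).filter (fun e => s(i, j) ∈ cut (⊤ : SimpleGraph V) (side T v e)) =
        ((treePath hT (i : W) j).edges.filter fun e => w ∈ e).toFinset := by
      ext e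
      simp only [Finset.mem_filter, List.mem_toFinset, List.mem_filter, decide_eq_true_eq,
        mem_edges_iff_mem_cut_side hT v hij hp]
      induction e with | _ b c
      rw [mem_cut]
      simp only [Set.mem_singleton_iff, Sym2.mem_iff, mem_edgeSet]
      constructor
      · rintro ⟨⟨h1, h2⟩, h3⟩
        exact ⟨⟨h1, h3⟩, by tauto⟩
      · rintro ⟨⟨h1, h3⟩, h2⟩
        have := h1.ne
        refine ⟨⟨h1, fun h => this ?_⟩, h3⟩
        rcases h2 with rfl | rfl
        · exact (h.1 rfl).symm
        · exact h.2 rfl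
    rw [heq, List.toFinset_card_of_nodup (hp.isTrail.edges_nodup.filter _),
      ← List.countP_eq_length_filter, hp.isTrail.even_countP_edges_iff]
    exact fun _ => ⟨fun h => hw (h ▸ i.2), fun h => hw (h ▸ j.2)⟩
  · intro e _
    refine maxReq_le r fun i hi j hj => ?_
    have := hy.2 i j (fun h => hj (h ▸ hi)) _ hi hj
    beta_reduce at this
    unfold treeLoad
    exact_mod_cast this

theorem cost_treeLoad (hT : T.IsTree) (ha : IsRepresentedBy a T l) (v : V) (y : Sym2 V → ℕ) :
    cost T l (fun e => (treeLoad T v y e : ℝ)) =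
      cost (⊤ : SimpleGraph V) a (fun e => (y e : ℝ)) := by
  classical
  unfold cost treeLoad
  push_cast
  simp only [Finset.mul_sum]
  rw [Finset.sum_comm' (t' := (⊤ : SimpleGraph V).edgeFinset) (s' := fun f =>
    T.edgeFinset.filter fun e => f ∈ cut (⊤ : SimpleGraph V) (side T v e))]
  · refine Finset.sum_congr (by ext; simp) fun f hf => ?_
    rw [← Finset.sum_mul]
    congr 1
    induction f with | _ i j
    have hij : i ≠ j := by simpa using hf
    have hp := isPath_treePath hT (i : W) j
    rw [ha i j hij _ hp, ← List.sum_toFinset _ hp.isTrail.edges_nodup]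
    refine Finset.sum_congr ?_ fun _ _ => rfl
    ext e
    simp only [Finset.mem_filter, List.mem_toFinset, mem_edges_iff_mem_cut_side hT v hij hp,
      mem_edgeFinset]
  · intro e f
    induction f with | _ i j
    simp only [Finset.mem_filter, mem_edgeFinset, mem_edgeSet, mem_cut]
    tauto

/-- The multigraph with `c e` copies of each edge `e` of `T`. -/
noncomputable def copies (T : SimpleGraph W) (c : Sym2 W → ℕ) : Multiset (Sym2 W) :=
  open scoped Classical in
  ∑ e ∈ T.edgeFinset, Multiset.replicate (c e) e

theorem sum_map_copies {M : Type*} [AddCommMonoid M] [DecidableEq W] [DecidableRel T.Adj]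
    (c : Sym2 W → ℕ) (g : Sym2 W → M) :
    ((copies T c).map g).sum = ∑ e ∈ T.edgeFinset, c e • g e := by
  classical
  have : ∀ S : Finset (Sym2 W), ((∑ e ∈ S, Multiset.replicate (c e) e).map g).sum =
      ∑ e ∈ S, c e • g e := by
    intro S
    induction S using Finset.induction_on with
    | empty => simp
    | insert e S he ih => simp [Finset.sum_insert he, ih]
  unfold copies
  rw [this]
  exact Finset.sum_congr (by ext; simp) fun _ _ => rfl

theorem cutSize_copies [DecidableEq W] (c : Sym2 W → ℕ) (X : Finset W) :
    cutSize (copies T c) X = ∑ e ∈ cut T (X : Set W), c e := by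
  classical
  rw [cutSize, between, sum_map_copies]
  have hsub : cut T (X : Set W) ⊆ T.edgeFinset := by
    intro e
    induction e with | _ x y
    rw [mem_cut]
    simp +contextual
  rw [← Finset.sum_subset hsub]
  · refine Finset.sum_congr rfl fun e he => ?_
    induction e with | _ x y
    rw [mem_cut] at he
    rw [joins_mk, if_pos]
    · simp
    · simp only [Finset.mem_coe] at he
      simp only [Finset.mem_compl]
      tauto
  · intro e he he'
    induction e with | _ x y
    rw [mem_cut] at he'
    rw [joins_mk, if_neg]
    · simp
    · simp only [Finset.mem_coe, mem_edgeFinset, mem_edgeSet] at he he'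
      simp only [Finset.mem_compl]
      tauto

/-- A feasible tree capacity can be turned into a realization that is no more expensive. -/
theorem exists_realization (hT : T.IsTree) (hl : ∀ e ∈ T.edgeSet, 0 ≤ l e)
    (ha : IsRepresentedBy a T l) (hr : ∀ i j : V, r i j = r j i)
    (hR : ∀ e ∈ T.edgeSet, 1 < maxReq r (side T v e)) {c : Sym2 W → ℕ}
    (hc : IsFeasible T r v c) :
    ∃ y : Sym2 V → ℕ, IsIntegerRealization r y ∧
      cost (⊤ : SimpleGraph V) a (fun e => (y e : ℝ)) ≤ cost T l (fun e => (c e : ℝ)) := by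
  classical
  -- Raising the requirement to at least 2 is free, since every tree edge has `c e ≥ 2`, and it
  -- supplies the lower bound on cuts separating `V`.
  let ρ : W → W → ℕ := fun i j =>
    if h : (i ∈ V ∧ j ∈ V) ∧ i ≠ j then max 2 (r ⟨i, h.1.1⟩ ⟨j, h.1.2⟩) else 0
  have hρ : ∀ i j, ρ i j = ρ j i := by
    intro i j
    by_cases h : (i ∈ V ∧ j ∈ V) ∧ i ≠ j
    · have h' : (j ∈ V ∧ i ∈ V) ∧ j ≠ i := ⟨h.1.symm, h.2.symm⟩
      simp only [ρ, dif_pos h, dif_pos h', hr ⟨i, h.1.1⟩]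
    · have h' : ¬((j ∈ V ∧ i ∈ V) ∧ j ≠ i) := fun h' => h ⟨h'.1.symm, h'.2.symm⟩
      simp only [ρ, dif_neg h, dif_neg h']
  have hreq : ∀ X, req ρ X ≤ cutSize (copies T c) X := by
    intro X
    rw [req_le_iff hρ]
    intro i hi j hj
    by_cases h : (i ∈ V ∧ j ∈ V) ∧ i ≠ j
    · simp only [ρ, dif_pos h]
      have hp := isPath_treePath hT i j
      obtain ⟨d, hd, hd1, hd2⟩ := (treePath hT i j).exists_boundary_dart (X : Set W) hi hj
      have hde : d.edge ∈ (treePath hT i j).edges := List.mem_map_of_mem hd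
      have hdcut : d.edge ∈ cut T (X : Set W) := by
        rw [Dart.edge, Sym2.mk, mem_cut]
        exact ⟨d.adj, by tauto⟩
      obtain ⟨heT, hsep⟩ := (mem_edges_iff_mem_cut_side hT v
        (i := ⟨i, h.1.1⟩) (j := ⟨j, h.1.2⟩) (by simpa using h.2) hp).1 hde
      rw [mem_cut] at hsep
      have h1 := hc.2 _ heT
      have h2 := hR _ heT
      have h3 : r ⟨i, h.1.1⟩ ⟨j, h.1.2⟩ ≤ maxReq r (side T v d.edge) := by
        by_cases hi' : (⟨i, h.1.1⟩ : V) ∈ side T v d.edge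
        · exact le_maxReq r hi' (by tauto)
        · rw [hr]
          exact le_maxReq r (by tauto) hi'
      rw [cutSize_copies]
      have h4 := Finset.single_le_sum (f := c) (fun _ _ => Nat.zero_le _) hdcut
      omega
    · simp only [ρ, dif_neg h, Nat.zero_le]
  obtain ⟨E, hE0, hEreq, hEcost⟩ := exists_eliminated (V : Set W) (treeDist hT l)
    (treeDist_triangle hT hl) hρ
    (fun i hi j => dif_neg fun h => hi h.1.1)
    (fun i hi j hj hij => by simp only [ρ, dif_pos (⟨⟨hi, hj⟩, hij⟩ : (i ∈ V ∧ j ∈ V) ∧ i ≠ j),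
      le_max_left])
    (copies T c) (fun w hw => by simpa [cutSize_copies] using hc.1 w hw) hreq
  have hinj : Function.Injective (Sym2.map (Subtype.val : V → W)) :=
    Sym2.map.injective Subtype.val_injective
  refine ⟨fun f => E.count (f.map Subtype.val), ⟨fun e _ => Nat.cast_nonneg _, ?_⟩, ?_⟩
  · intro s t hst X hs ht
    let X' : Finset W := Finset.univ.filter fun w => ∃ h : w ∈ V, (⟨w, h⟩ : V) ∈ X
    have hX' : ∀ u : V, (u : W) ∈ X' ↔ u ∈ X := by
      intro u
      simp [X']
    have hle : r s t ≤ req ρ X' := by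
      have h1 := @le_req _ _ _ _ hρ X' (s : W) (t : W) (by simp [hX', hs, ht])
      have h2 : (((s : W) ∈ V ∧ (t : W) ∈ V) ∧ (s : W) ≠ t) :=
        ⟨⟨s.2, t.2⟩, fun h => hst (Subtype.ext h)⟩
      have h3 : ρ s t = max 2 (r s t) := dif_pos h2
      omega
    have hcut : cutSize E X' ≤ ∑ f ∈ cut (⊤ : SimpleGraph V) X, E.count (f.map Subtype.val) := by
      rw [cutSize, between, Finset.sum_multiset_map_count,
        ← Finset.sum_image (g := Sym2.map (Subtype.val : V → W)) (f := fun e => E.count e)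
          (fun _ _ _ _ h => hinj h)]
      calc ∑ e ∈ E.toFinset, E.count e • joins X' X'ᶜ e
          ≤ ∑ e ∈ (cut (⊤ : SimpleGraph V) X).image (Sym2.map (Subtype.val : V → W)),
              E.count e • joins X' X'ᶜ e := by
            refine Finset.sum_le_sum_of_ne_zero fun e he hne => ?_
            rw [Multiset.mem_toFinset] at he
            induction e with | _ x y
            have hxy : ¬(x ∈ X' ↔ y ∈ X') := by
              intro h
              apply hne
              rw [joins_mk, if_neg, smul_zero]
              simp only [Finset.mem_compl]
              tauto
            have hne' : x ≠ y := fun h => hxy (h ▸ Iff.rfl)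
            have hin : ∀ x y, x ≠ y → s(x, y) ∈ E → x ∈ V := by
              intro x y hne h
              by_contra hx
              have := (between_pos_iff E {x} {x}ᶜ).2 ⟨x, by simp, y, by simpa using hne.symm, h⟩
              exact this.ne' (hE0 x hx)
            have hx := hin x y hne' he
            have hy := hin y x hne'.symm (Sym2.eq_swap ▸ he)
            refine Finset.mem_image.2 ⟨s(⟨x, hx⟩, ⟨y, hy⟩), ?_, rfl⟩
            rw [mem_cut, ← hX', ← hX']
            exact ⟨fun h => hne' (congrArg Subtype.val h), hxy⟩
        _ ≤ _ := by
            refine Finset.sum_le_sum fun e _ => ?_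
            induction e with | _ x y
            rw [joins_mk]
            split_ifs <;> simp
    beta_reduce
    exact_mod_cast hle.trans ((hEreq X').trans hcut)
  · have hcopies : ((copies T c).map (treeDist hT l)).sum = cost T l (fun e => (c e : ℝ)) := by
      rw [sum_map_copies]
      refine Finset.sum_congr rfl fun e he => ?_
      rw [treeDist_of_adj hT l (by simpa using he), nsmul_eq_mul, mul_comm]
    rw [← hcopies]
    refine le_trans ?_ hEcost
    calc cost (⊤ : SimpleGraph V) a (fun f => (E.count (f.map Subtype.val) : ℝ))
        = ∑ f ∈ (⊤ : SimpleGraph V).edgeFinset,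
            treeDist hT l (f.map Subtype.val) * E.count (f.map Subtype.val) := by
          unfold cost
          refine Finset.sum_congr (by ext; simp) fun f hf => ?_
          induction f with | _ i j
          have hij : i ≠ j := by simpa using hf
          rw [ha i j hij _ (isPath_treePath hT (i : W) j), Sym2.map_mk,
            treeDist_eq hT l (isPath_treePath hT (i : W) j)]
          rfl
      _ = ∑ e ∈ (⊤ : SimpleGraph V).edgeFinset.image (Sym2.map (Subtype.val : V → W)),
            treeDist hT l e * E.count e := by
          rw [Finset.sum_image fun _ _ _ _ h => hinj h]
      -- Splitting may leave loops in `E`, which `y` ignores; nonnegative distances allow for them.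
      _ ≤ ∑ e, treeDist hT l e * E.count e :=
          Finset.sum_le_sum_of_subset_of_nonneg (Finset.subset_univ _) fun e _ _ =>
            mul_nonneg (treeDist_nonneg hT hl e) (Nat.cast_nonneg _)
      _ = ∑ e ∈ E.toFinset, treeDist hT l e * E.count e := by
          symm
          refine Finset.sum_subset (Finset.subset_univ _) fun e _ he => ?_
          rw [Multiset.mem_toFinset] at he
          simp [Multiset.count_eq_zero_of_notMem he]
      _ = (E.map (treeDist hT l)).sum := by
          rw [Finset.sum_multiset_map_count]
          exact Finset.sum_congr rfl fun e _ => by rw [nsmul_eq_mul, mul_comm]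

/-- The minimum cost of a feasible tree capacity is attained. -/
theorem exists_min_feasible (T : SimpleGraph W) (hl : ∀ e ∈ T.edgeSet, 0 ≤ l e) (r : V → V → ℕ)
    (v : V) : ∃ c, IsFeasible T r v c ∧ ∀ c', IsFeasible T r v c' →
      cost T l (fun e => (c e : ℝ)) ≤ cost T l (fun e => (c' e : ℝ)) := by
  classical
  let R : Sym2 W → ℕ := fun e => maxReq r (side T v e)
  let S : Set (Sym2 W → ℕ) := {c | IsFeasible T r v c} ∩ Set.Iic fun e => R e + 1
  have hred : ∀ c', IsFeasible T r v c' → ∃ c ∈ S,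
      cost T l (fun e => (c e : ℝ)) ≤ cost T l (fun e => (c' e : ℝ)) := by
    intro c' hc'
    -- The least value that is at least `R e` and has the parity of `c' e`; so only finitely many
    -- capacities compete.
    refine ⟨fun e => R e + (c' e + R e) % 2, ⟨⟨fun w hw => ?_, fun e _ => ?_⟩, fun e => ?_⟩, ?_⟩
    · have h1 := hc'.1 w hw
      rw [Nat.even_iff, Finset.sum_nat_mod] at h1 ⊢
      rw [← h1]
      congr 1
      exact Finset.sum_congr rfl fun e _ => by omega
    · exact Nat.le_add_right _ _
    · change R e + (c' e + R e) % 2 ≤ R e + 1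
      omega
    · refine Finset.sum_le_sum fun e he => ?_
      have heT : e ∈ T.edgeSet := by simpa using he
      refine mul_le_mul_of_nonneg_left ?_ (hl e heT)
      have : R e ≤ c' e := hc'.2 e heT
      beta_reduce
      exact_mod_cast (by omega : R e + (c' e + R e) % 2 ≤ c' e)
  have hfeas : IsFeasible T r v fun e => 2 * R e :=
    ⟨fun w _ => Finset.even_sum _ fun e _ => even_two_mul _, fun e _ => by
      change R e ≤ 2 * R e
      omega⟩
  obtain ⟨c₀, hc₀, -⟩ := hred _ hfeas
  obtain ⟨c, hc, hmin⟩ := Set.exists_min_image S (fun c => cost T l (fun e => (c e : ℝ)))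
    ((Set.finite_Iic _).subset Set.inter_subset_right) ⟨c₀, hc₀⟩
  refine ⟨c, hc.1, fun c' hc' => ?_⟩
  obtain ⟨c₁, hc₁, hle⟩ := hred c' hc'
  exact (hmin c₁ hc₁).trans hle

end Transfer

end NetworkSynthesis

theorem corollary3p2 {W : Type*} [Fintype W] (V : Finset W) (T : SimpleGraph W) (hT : T.IsTree)
    (l : Sym2 W → ℝ) (hl : ∀ e ∈ T.edgeSet, 0 ≤ l e)
    (a : Sym2 V → ℝ) (ha : NetworkSynthesis.IsRepresentedBy a T l)
    (r : V → V → ℕ) (hr : ∀ i j : V, r i j = r j i) (v : V)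
    (hR : ∀ e ∈ T.edgeSet, 1 < NetworkSynthesis.maxReq r (NetworkSynthesis.side T v e)) :
    ∃ m : ℝ,
      IsLeast {x : ℝ | ∃ y : Sym2 V → ℕ, NetworkSynthesis.IsIntegerRealization r y ∧
        x = NetworkSynthesis.cost (⊤ : SimpleGraph V) a (fun e => (y e : ℝ))} m ∧
      IsLeast {x : ℝ | ∃ c : Sym2 W → ℕ, NetworkSynthesis.IsFeasible T r v c ∧
        x = NetworkSynthesis.cost T l (fun e => (c e : ℝ))} m := by
  obtain ⟨c, hc, hmin⟩ := NetworkSynthesis.exists_min_feasible T hl r v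
  obtain ⟨y, hy, hle⟩ := NetworkSynthesis.exists_realization hT hl ha hr hR hc
  have hlower : ∀ y', NetworkSynthesis.IsIntegerRealization r y' →
      NetworkSynthesis.cost T l (fun e => (c e : ℝ)) ≤
        NetworkSynthesis.cost (⊤ : SimpleGraph V) a (fun e => (y' e : ℝ)) := by
    intro y' hy'
    rw [← NetworkSynthesis.cost_treeLoad hT ha v y']
    exact hmin _ (NetworkSynthesis.isFeasible_treeLoad hT hy')
  refine ⟨_, ⟨⟨y, hy, le_antisymm (hlower y hy) hle⟩, ?_⟩, ⟨⟨c, hc, rfl⟩, ?_⟩⟩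
  · rintro _ ⟨y', hy', rfl⟩
    exact hlower y' hy'
  · rintro _ ⟨c', hc', rfl⟩
    exact hmin c' hc'
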